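/- **Lemma.** Let $H$ be a complex random variable with $\mathbb{E}|H|^2=1$, let $S_T$ (the channel state information at the transmitter) and $S_R$ (the channel state information at the receiver) be random variables with arbitrary alphabets $\mathcal S_T$, $\mathcal S_R$, where $(H,S_T,S_R)$ may have an arbitrary joint distribution, and put $G=|H|^2$. An adaptive symbol $A$ is a random function $X_A(\cdot):\mathcal S_T\to\mathbb{C}$ with an arbitrary distribution; the channel input is $X=X_A(S_T)$, and the fading channel with AWGN has the output $$Y = HX+Z,\qquad Z\sim\mathcal{CN}(0,1),$$ where $A$, $(H,S_T,S_R)$ and $Z$ are mutually independent, and the receiver sees $[Y,S_R]$. For $P\ge 0$ the capacity (in nats) under the power constraint $\mathbb{E}|X|^2\le P$ is $$C(P)=\sup_{A:\ \mathbb{E}|X|^2\le P} I(A;Y\mid S_R),$$ where $I(A;Y\mid S_R)$ is the average mutual information of $A$ and $Y$ conditioned on $S_R$. Then $$C(P)\ \le\ \max_{P(\cdot)}\ \mathbb{E}\big[\log\big(1+G\,P(S_T)\big)\big],$$ where the maximum is over all measurable power policies $P(\cdot):\mathcal S_T\to[0,\infty)$ with $\mathbb{E}[P(S_T)]\le P$,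 and log is the natural logarithm. This maximum is attained and finite. -/

import Mathlib

open MeasureTheory ProbabilityTheory InformationTheory
open scoped ENNReal NNReal

universe u v w

noncomputable section

namespace FadingAWGN

/-- The circularly symmetric complex Gaussian law `CN(0,1)`, given by its density
`π⁻¹ exp (-|z|²)` with respect to Lebesgue measure on `ℂ`. -/
def stdCSCG : Measure ℂ :=
  (volume : Measure ℂ).withDensity
    (fun z => ENNReal.ofReal (Real.pi⁻¹ * Real.exp (-‖z‖ ^ 2)))

instance isProbabilityMeasure_stdCSCG : IsProbabilityMeasure stdCSCG := by
  have key := GaussianFourier.integral_rexp_neg_mul_sq_norm (V := ℂ) (b := 1) one_pos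
  have h1 : ∫ z : ℂ, Real.exp (-‖z‖ ^ 2) = Real.pi := by
    simpa [Complex.finrank_real_complex] using key
  have hint : Integrable (fun z : ℂ => Real.exp (-‖z‖ ^ 2)) := by
    by_contra h
    rw [integral_undef h] at h1
    exact Real.pi_ne_zero h1.symm
  constructor
  rw [stdCSCG, withDensity_apply _ MeasurableSet.univ, Measure.restrict_univ,
    ← ofReal_integral_eq_lintegral_ofReal (hint.const_mul _)
      (Filter.Eventually.of_forall fun z => by positivity),
    integral_const_mul, h1, inv_mul_cancel₀ Real.pi_ne_zero, ENNReal.ofReal_one]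

/-- The average conditional mutual information `I(A;Y|S)` in nats of random variables `A`, `Y`, `S`
on `(Ω, μ)`: the informational divergence between the joint law `P_{ASY}` and the law
`P_{AS} P_{Y|S}` under which `A - S - Y` is a Markov chain with the same laws of `(A,S)` and
`(S,Y)`. -/
def condMutualInfo {Ω 𝓐 𝓨 𝓢 : Type*} [MeasurableSpace Ω] [MeasurableSpace 𝓐]
    [MeasurableSpace 𝓨] [StandardBorelSpace 𝓨] [Nonempty 𝓨] [MeasurableSpace 𝓢]
    (μ : Measure Ω) [IsFiniteMeasure μ] (A : Ω → 𝓐) (Y : Ω → 𝓨) (S : Ω → 𝓢) : ℝ≥0∞ :=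
  klDiv (μ.map (fun ω => ((A ω, S ω), Y ω)))
    ((μ.map (fun ω => (A ω, S ω))) ⊗ₘ (Kernel.prodMkLeft 𝓐 (condDistrib Y S μ)))

variable {𝓢T : Type v} {𝓢R : Type w} [MeasurableSpace 𝓢T] [MeasurableSpace 𝓢R]

/-- A random adaptive symbol `A` (Shannon strategy): a random function from the CSIT alphabet to
the complex plane, with an arbitrary distribution.  The realizations are indexed by `a : Alphabet`;
the realization `a` is the function `X_a(·) = input a`, and `input a s` is the channel input that is
transmitted if the CSIT is `s`. -/
structure AdaptiveSymbol (𝓢T : Type v) [MeasurableSpace 𝓢T] where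
  /-- the index set of the realizations of `A` -/
  Alphabet : Type u
  [mAlphabet : MeasurableSpace Alphabet]
  /-- the distribution of `A` -/
  law : Measure Alphabet
  [isProb : IsProbabilityMeasure law]
  /-- the channel input as a function of the realization of `A` and of the CSIT -/
  input : Alphabet → 𝓢T → ℂ
  measurable_input : Measurable (Function.uncurry input)

attribute [instance] AdaptiveSymbol.mAlphabet AdaptiveSymbol.isProb

namespace AdaptiveSymbol

/-- The sample space: points are `(a, (h, sT, sR), z)`, i.e., the realizations of the adaptive
symbol, of the channel state `(H, S_T, S_R)` and of the noise `Z`. -/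
abbrev Sample (A : AdaptiveSymbol.{u, v} 𝓢T) (𝓢R : Type w) : Type (max u v w) :=
  A.Alphabet × (ℂ × 𝓢T × 𝓢R) × ℂ

/-- The joint law of `(A, (H, S_T, S_R), Z)`: these are mutually independent, `(H, S_T, S_R)` has
law `Q`, and `Z ∼ CN(0,1)`. -/
abbrev jointLaw (A : AdaptiveSymbol.{u, v} 𝓢T) (Q : Measure (ℂ × 𝓢T × 𝓢R)) :
    Measure (A.Sample 𝓢R) :=
  A.law.prod (Q.prod stdCSCG)

/-- The adaptive symbol as a random variable on the sample space. -/
def symbol (A : AdaptiveSymbol.{u, v} 𝓢T) (ω : A.Sample 𝓢R) : A.Alphabet := ω.1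

/-- The CSIR `S_R`. -/
def csir (A : AdaptiveSymbol.{u, v} 𝓢T) (ω : A.Sample 𝓢R) : 𝓢R := ω.2.1.2.2

/-- The channel input `X = X(S_T)`. -/
def X (A : AdaptiveSymbol.{u, v} 𝓢T) (ω : A.Sample 𝓢R) : ℂ := A.input ω.1 ω.2.1.2.1

/-- The channel output `Y = H X + Z`. -/
def Y (A : AdaptiveSymbol.{u, v} 𝓢T) (ω : A.Sample 𝓢R) : ℂ := ω.2.1.1 * A.X ω + ω.2.2

/-- The average transmit power `E|X|²`. -/
def power (A : AdaptiveSymbol.{u, v} 𝓢T) (Q : Measure (ℂ × 𝓢T × 𝓢R)) : ℝ≥0∞ :=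
  ∫⁻ ω, ‖A.X ω‖ₑ ^ 2 ∂(A.jointLaw Q)

end AdaptiveSymbol

/-- The capacity `C(P) = max I(A;Y|S_R)` in nats per channel use (read as a supremum in `[0,∞]`)
over all adaptive symbols `A` with `E|X|² ≤ P`, of the fading channel `Y = H X + Z` with CSIT `S_T`
and CSIR `S_R`, where `Q` is the joint law of `(H, S_T, S_R)`. -/
def capacity (Q : Measure (ℂ × 𝓢T × 𝓢R)) [IsProbabilityMeasure Q] (P : ℝ≥0) : ℝ≥0∞ :=
  ⨆ (A : AdaptiveSymbol.{u, v} 𝓢T) (_ : A.power Q ≤ P),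
    condMutualInfo (A.jointLaw Q) A.symbol A.Y A.csir

/-- The power control policies `P(·)` with `E[P(S_T)] ≤ P`. -/
def powerPolicies (Q : Measure (ℂ × 𝓢T × 𝓢R)) (P : ℝ≥0) : Set (𝓢T → ℝ≥0) :=
  {p | Measurable p ∧ ∫⁻ ω, (p ω.2.1 : ℝ≥0∞) ∂Q ≤ P}

/-- `E[log(1 + G P(S_T))]` with `G = |H|²`, as the integral of a nonnegative function. -/
def policyRate (Q : Measure (ℂ × 𝓢T × 𝓢R)) (p : 𝓢T → ℝ≥0) : ℝ≥0∞ :=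
  ∫⁻ ω, ENNReal.ofReal (Real.log (1 + ‖ω.1‖ ^ 2 * (p ω.2.1 : ℝ))) ∂Q

end FadingAWGN

end

/-!
The upper bound compares the channel output with Gaussian noise of the same conditional power. As
the adaptive symbol `A` is independent of the channel state `W = (H, S_T, S_R)`, data processing
and the variational characterization of mutual information bound `I(A; Y | S_R)` by the divergence
`D(P_{Y|A,W} ‖ η | P_A P_W)` for every output kernel `η` from `W`. With `η = CN(0, 1 + G P(S_T))`
and `P(s) = E|X_A(s)|²`, the quadratic terms of the divergence between the Gaussian laws cancel on
averaging over `A`, and `E[log(1 + G P(S_T))]` is left.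

For the attainment, let `p` and `q` be two policies and let `x` be the difference of their rates
`log(1 + G p)` and `log(1 + G q)`. The rate of the midpoint policy exceeds the mean of the two rates
by exactly `log cosh (x / 2)`. Hence along a sequence of policies that approach the supremum fast
enough, the rates converge almost surely. The lower limit of the policies satisfies the power
constraint by Fatou's lemma. Since `log(1 + G P) ≤ log(1 + G) - log ε + ε P`, no rate is lost in
the limit.
-/

namespace FadingAWGN
section Divergence

variable {α β : Type*} [MeasurableSpace α] [MeasurableSpace β]

lemma klDiv_le_klDiv_of_integral_llr_nonneg {μ σ ν : Measure α} [IsFiniteMeasure μ]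
    [IsFiniteMeasure σ] [IsFiniteMeasure ν] (hμσ : μ ≪ σ) (hσν : σ ≪ ν)
    (hint : Integrable (llr σ ν) μ)
    (hnonneg : 0 ≤ ∫ x, llr σ ν x ∂μ + ν.real Set.univ - σ.real Set.univ) :
    klDiv μ σ ≤ klDiv μ ν := by
  by_cases htop : klDiv μ ν = ∞
  · simp [htop]
  obtain ⟨hμν, hintν⟩ := klDiv_ne_top_iff.mp htop
  have hllr : llr μ σ =ᵐ[μ] llr μ ν - llr σ ν := by
    filter_upwards [hμν.ae_le (Measure.rnDeriv_mul_rnDeriv hμσ), Measure.rnDeriv_pos hμσ,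
      hμσ.ae_le (Measure.rnDeriv_lt_top μ σ), hμσ.ae_le (Measure.rnDeriv_pos hσν),
      hμν.ae_le (Measure.rnDeriv_lt_top σ ν)] with x hmul hpos hfin hpos' hfin'
    simp only [Pi.sub_apply, llr, ← hmul, Pi.mul_apply, ENNReal.toReal_mul]
    rw [Real.log_mul (ENNReal.toReal_pos hpos.ne' hfin.ne).ne'
      (ENNReal.toReal_pos hpos'.ne' hfin'.ne).ne', add_sub_cancel_right]
  rw [klDiv_of_ac_of_integrable hμσ ((hintν.sub hint).congr hllr.symm),
    klDiv_of_ac_of_integrable hμν hintν, integral_congr_ae hllr, integral_sub' hintν hint]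
  exact ENNReal.ofReal_le_ofReal (by linarith)

lemma absolutelyContinuous_fst_compProd {π : Measure (α × β)} [SFinite π] {ν : Measure α}
    {κ : Kernel α β} [IsSFiniteKernel κ] (h : π ≪ ν ⊗ₘ κ) : π ≪ π.fst ⊗ₘ κ := by
  refine Measure.AbsolutelyContinuous.mk fun N hN hN0 => ?_
  have hslice : Measurable fun a => κ a (Prod.mk a ⁻¹' N) :=
    Kernel.measurable_kernel_prodMk_left hN
  have hfst : ∀ᵐ x ∂π, κ x.1 (Prod.mk x.1 ⁻¹' N) = 0 := by
    rw [Measure.compProd_apply hN, lintegral_eq_zero_iff hslice] at hN0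
    exact ae_of_ae_map measurable_fst.aemeasurable hN0
  have hnull : ∀ᵐ x ∂π, ¬ (κ x.1 (Prod.mk x.1 ⁻¹' N) = 0 ∧ x ∈ N) := by
    refine h.ae_le (Measure.ae_compProd_of_ae_ae ?_ (Filter.Eventually.of_forall fun a => ?_))
    · exact (((hslice.comp measurable_fst) (measurableSet_singleton 0)).inter hN).compl
    · by_cases ha : κ a (Prod.mk a ⁻¹' N) = 0
      · filter_upwards [measure_eq_zero_iff_ae_notMem.mp ha] with b hb using fun hab => hb hab.2
      · exact Filter.Eventually.of_forall fun b hab => ha hab.1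
  refine measure_eq_zero_iff_ae_notMem.mpr ?_
  filter_upwards [hfst, hnull] with x h0 hx hxN using hx ⟨h0, hxN⟩

lemma klDiv_fst_compProd_le (π : Measure (α × β)) [IsFiniteMeasure π] (ν : Measure α)
    [IsFiniteMeasure ν] (κ : Kernel α β) [IsMarkovKernel κ] :
    klDiv π (π.fst ⊗ₘ κ) ≤ klDiv π (ν ⊗ₘ κ) := by
  by_cases htop : klDiv π (ν ⊗ₘ κ) = ∞
  · simp [htop]
  have hac : π ≪ ν ⊗ₘ κ := (klDiv_ne_top_iff.mp htop).1
  have hfst : klDiv π.fst ν ≤ klDiv π (ν ⊗ₘ κ) := by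
    calc klDiv π.fst ν = klDiv π.fst (ν ⊗ₘ κ).fst := by rw [Measure.fst_compProd]
      _ ≤ klDiv π (ν ⊗ₘ κ) := klDiv_map_le π (ν ⊗ₘ κ) measurable_fst
  obtain ⟨hac₁, hint₁⟩ := klDiv_ne_top_iff.mp (ne_top_of_le_ne_top htop hfst)
  have hllr : llr (π.fst ⊗ₘ κ) (ν ⊗ₘ κ) =ᵐ[π] fun x => llr π.fst ν x.1 := by
    filter_upwards [hac.ae_le (rnDeriv_measure_compProd_left π.fst ν κ)] with x hx
    rw [llr, llr, hx]
  refine klDiv_le_klDiv_of_integral_llr_nonneg (absolutelyContinuous_fst_compProd hac)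
    (hac₁.compProd_left κ) ((hint₁.comp_measurable measurable_fst).congr hllr.symm) ?_
  have hnonneg := integral_llr_add_sub_measure_univ_nonneg hac₁ hint₁
  have hπ : ∫ a, llr π.fst ν a ∂π.fst = ∫ x, llr π.fst ν x.1 ∂π :=
    integral_map measurable_fst.aemeasurable (measurable_llr _ _).aestronglyMeasurable
  have huniv (m : Measure α) [IsFiniteMeasure m] :
      (m ⊗ₘ κ).real Set.univ = m.real Set.univ := by
    simp [measureReal_def]
  rwa [integral_congr_ae hllr, huniv, huniv, ← hπ]

lemma rnDeriv_compProd_right (μ : Measure α) [IsFiniteMeasure μ] {κ η : Kernel α β}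
    [IsFiniteKernel κ] [IsFiniteKernel η] [MeasurableSpace.CountableOrCountablyGenerated α β]
    (hac : ∀ᵐ a ∂μ, κ a ≪ η a) :
    (μ ⊗ₘ κ).rnDeriv (μ ⊗ₘ η) =ᵐ[μ ⊗ₘ η] fun x => κ.rnDeriv η x.1 x.2 := by
  have hκ : μ ⊗ₘ κ = (μ ⊗ₘ η).withDensity fun x => κ.rnDeriv η x.1 x.2 := by
    rw [← Measure.compProd_withDensity (by fun_prop)]
    refine Measure.compProd_congr ?_
    filter_upwards [hac] with a ha using (Kernel.withDensity_rnDeriv_eq ha).symm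
  rw [hκ]
  exact Measure.rnDeriv_withDensity _ (by fun_prop)

lemma klDiv_compProd_right (μ : Measure α) [IsFiniteMeasure μ] {κ η : Kernel α β}
    [IsFiniteKernel κ] [IsFiniteKernel η] [MeasurableSpace.CountableOrCountablyGenerated α β]
    (hac : ∀ᵐ a ∂μ, κ a ≪ η a) :
    klDiv (μ ⊗ₘ κ) (μ ⊗ₘ η) = ∫⁻ a, klDiv (κ a) (η a) ∂μ := by
  have hκη : μ ⊗ₘ κ ≪ μ ⊗ₘ η := Measure.absolutelyContinuous_compProd_right_iff.mpr hac
  have hrn : ∀ᵐ x ∂(μ ⊗ₘ η), ENNReal.ofReal (klFun ((μ ⊗ₘ κ).rnDeriv (μ ⊗ₘ η) x).toReal)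
      = ENNReal.ofReal (klFun (κ.rnDeriv η x.1 x.2).toReal) := by
    filter_upwards [rnDeriv_compProd_right μ hac] with x hx
    rw [hx]
  rw [klDiv_eq_lintegral_klFun_of_ac hκη, lintegral_congr_ae hrn,
    Measure.lintegral_compProd (by have := measurable_klFun; fun_prop)]
  refine lintegral_congr_ae ?_
  filter_upwards [hac] with a ha
  rw [klDiv_eq_lintegral_klFun_of_ac ha]
  refine lintegral_congr_ae ?_
  filter_upwards [Kernel.rnDeriv_eq_rnDeriv_measure (κ := κ) (η := η) (a := a)] with b hb
  rw [hb]

lemma prod_compProd_prodMkLeft {γ : Type*} [MeasurableSpace γ] (ρ : Measure γ) (μ : Measure α)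
    (κ : Kernel α β) [SFinite ρ] [SFinite μ] [IsSFiniteKernel κ] :
    (ρ.prod μ) ⊗ₘ (Kernel.prodMkLeft γ κ)
      = (ρ.prod (μ ⊗ₘ κ)).map MeasurableEquiv.prodAssoc.symm := by
  rw [← Measure.compProd_const, ← Measure.compProd_assoc, ← Measure.compProd_const]
  congr 2
  ext1 c
  rw [Kernel.compProd_apply_eq_compProd_sectR, Kernel.sectR_prodMkLeft, Kernel.const_apply,
    Kernel.const_apply]

end Divergence
section MutualInformation

variable {Ω 𝓐 𝓨 𝓢 𝓦 : Type*} [MeasurableSpace Ω] [MeasurableSpace 𝓐] [MeasurableSpace 𝓨]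
  [StandardBorelSpace 𝓨] [Nonempty 𝓨] [MeasurableSpace 𝓢] [MeasurableSpace 𝓦]
  {μ : Measure Ω} [IsProbabilityMeasure μ] {A : Ω → 𝓐} {Y : Ω → 𝓨}

lemma condMutualInfo_le_klDiv_of_indepFun {S : Ω → 𝓢} (hA : Measurable A) (hY : Measurable Y)
    (hS : Measurable S) (hAS : IndepFun A S μ) (ν : Measure (𝓢 × 𝓨)) [IsFiniteMeasure ν] :
    condMutualInfo μ A Y S
      ≤ klDiv (μ.map fun ω => ((S ω, Y ω), A ω)) (ν.prod (μ.map A)) := by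
  have := Measure.isProbabilityMeasure_map (μ := μ) hA.aemeasurable
  set π := μ.map fun ω => ((S ω, Y ω), A ω) with hπ
  have hfst : π.fst = μ.map fun ω => (S ω, Y ω) := by
    rw [hπ, Measure.fst_map_prodMk hA]
  have hjoint : μ.map (fun ω => ((A ω, S ω), Y ω))
      = π.map (MeasurableEquiv.prodAssoc.symm ∘ Prod.swap) := by
    rw [hπ, Measure.map_map (by fun_prop) (by fun_prop)]
    rfl
  have hmarkov : (μ.map fun ω => (A ω, S ω)) ⊗ₘ Kernel.prodMkLeft 𝓐 (condDistrib Y S μ)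
      = (π.fst.prod (μ.map A)).map (MeasurableEquiv.prodAssoc.symm ∘ Prod.swap) := by
    rw [(indepFun_iff_map_prod_eq_prod_map_map hA.aemeasurable hS.aemeasurable).mp hAS,
      prod_compProd_prodMkLeft, compProd_map_condDistrib hY.aemeasurable, ← hfst,
      ← Measure.map_map (by fun_prop) (by fun_prop), Measure.prod_swap]
  calc condMutualInfo μ A Y S ≤ klDiv π (π.fst.prod (μ.map A)) := by
        rw [condMutualInfo, hjoint, hmarkov]
        exact klDiv_map_le _ _ (by fun_prop)
    _ ≤ klDiv π (ν.prod (μ.map A)) := by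
        simpa only [Measure.compProd_const] using
          klDiv_fst_compProd_le π ν (Kernel.const _ (μ.map A))

lemma condMutualInfo_comp_le_klDiv_of_indepFun {W : Ω → 𝓦} {g : 𝓦 → 𝓢} (hA : Measurable A)
    (hY : Measurable Y) (hW : Measurable W) (hg : Measurable g) (hAW : IndepFun A W μ)
    (η : Kernel 𝓦 𝓨) [IsMarkovKernel η] :
    condMutualInfo μ A Y (g ∘ W) ≤ klDiv (μ.map fun ω => ((A ω, W ω), Y ω))
      (((μ.map A).prod (μ.map W)) ⊗ₘ Kernel.prodMkLeft 𝓐 η) := by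
  have := Measure.isProbabilityMeasure_map (μ := μ) hA.aemeasurable
  have := Measure.isProbabilityMeasure_map (μ := μ) hW.aemeasurable
  set ν := ((μ.map W) ⊗ₘ η).map (Prod.map g id) with hν
  let T : (𝓐 × 𝓦) × 𝓨 → (𝓢 × 𝓨) × 𝓐 := fun x => ((g x.1.2, x.2), x.1.1)
  have hT : Measurable T := by fun_prop
  have hjoint : (μ.map fun ω => ((A ω, W ω), Y ω)).map T
      = μ.map fun ω => (((g ∘ W) ω, Y ω), A ω) :=
    Measure.map_map hT (by fun_prop)
  have hprod : (((μ.map A).prod (μ.map W)) ⊗ₘ Kernel.prodMkLeft 𝓐 η).map T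
      = ν.prod (μ.map A) := by
    have hνA := Measure.map_prod_map ((μ.map W) ⊗ₘ η) (μ.map A) (hg.prodMap measurable_id)
      measurable_id
    rw [Measure.map_id] at hνA
    rw [prod_compProd_prodMkLeft, hν, hνA, ← Measure.prod_swap,
      Measure.map_map hT (by fun_prop), Measure.map_map (by fun_prop) (by fun_prop)]
    rfl
  calc condMutualInfo μ A Y (g ∘ W)
      ≤ klDiv (μ.map fun ω => (((g ∘ W) ω, Y ω), A ω)) (ν.prod (μ.map A)) :=
        condMutualInfo_le_klDiv_of_indepFun hA hY (hg.comp hW) (hAW.comp measurable_id hg) ν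
    _ ≤ _ := by
        rw [← hjoint, ← hprod]
        exact klDiv_map_le _ _ hT

end MutualInformation
section Gaussian

lemma integral_norm_sq_stdCSCG : ∫ z, ‖z‖ ^ 2 ∂stdCSCG = 1 := by
  have hvol : ∫ z : ℂ, ‖z‖ ^ 2 * Real.exp (-‖z‖ ^ 2) = Real.pi := by
    have key := Complex.integral_rpow_mul_exp_neg_rpow (p := 2) (q := 2) (by norm_num)
      (by norm_num)
    norm_num [Real.Gamma_two] at key
    exact key
  have hdens (z : ℂ) : (ENNReal.ofReal (Real.pi⁻¹ * Real.exp (-‖z‖ ^ 2))).toReal • ‖z‖ ^ 2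
      = Real.pi⁻¹ * (‖z‖ ^ 2 * Real.exp (-‖z‖ ^ 2)) := by
    rw [ENNReal.toReal_ofReal (by positivity), smul_eq_mul]
    ring
  rw [stdCSCG, integral_withDensity_eq_integral_toReal_smul (by fun_prop)
    (Filter.Eventually.of_forall fun _ => ENNReal.ofReal_lt_top)]
  simp_rw [hdens]
  rw [integral_const_mul, hvol, inv_mul_cancel₀ Real.pi_ne_zero]

lemma integrable_norm_sq_stdCSCG : Integrable (fun z : ℂ => ‖z‖ ^ 2) stdCSCG :=
  .of_integral_ne_zero (by rw [integral_norm_sq_stdCSCG]; exact one_ne_zero)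

lemma memLp_two_id_stdCSCG : MemLp (fun z : ℂ => z) 2 stdCSCG :=
  (memLp_two_iff_integrable_sq_norm (by fun_prop)).mpr integrable_norm_sq_stdCSCG

lemma map_neg_stdCSCG : stdCSCG.map Neg.neg = stdCSCG := by
  refine Measure.ext_of_lintegral _ fun f hf => ?_
  rw [lintegral_map hf measurable_neg, stdCSCG,
    lintegral_withDensity_eq_lintegral_mul _ (by fun_prop) (by fun_prop),
    lintegral_withDensity_eq_lintegral_mul _ (by fun_prop) hf, ← lintegral_neg_eq_self]
  simp only [Pi.mul_apply, norm_neg, neg_neg]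

lemma integral_id_stdCSCG : ∫ z : ℂ, z ∂stdCSCG = 0 := by
  have hodd : ∫ z : ℂ, z ∂stdCSCG = -∫ z : ℂ, z ∂stdCSCG := by
    conv_lhs => rw [← map_neg_stdCSCG]
    rw [integral_map measurable_neg.aemeasurable (by fun_prop), integral_neg]
  exact self_eq_neg.mp hodd

/-- The circularly symmetric complex Gaussian law `CN(c, σ²)`, as a Markov kernel from its
parameters `(c, σ)`: the law of `c + σ Z` with `Z ∼ CN(0,1)`. -/
noncomputable def cscg : Kernel (ℂ × ℝ) ℂ :=
  (Kernel.id ×ₖ Kernel.const (ℂ × ℝ) stdCSCG).map fun x => x.1.1 + x.1.2 * x.2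

instance isMarkovKernel_cscg : IsMarkovKernel cscg :=
  Kernel.IsMarkovKernel.map _ (by fun_prop)

lemma cscg_apply (c : ℂ) (σ : ℝ) : cscg (c, σ) = stdCSCG.map fun z => c + σ * z := by
  rw [cscg, Kernel.map_apply _ (by fun_prop), Kernel.prod_apply, Kernel.id_apply,
    Kernel.const_apply, Measure.dirac_prod, Measure.map_map (by fun_prop) (by fun_prop)]
  rfl

lemma integrable_norm_sub_sq_cscg (c b : ℂ) (σ : ℝ) :
    Integrable (fun y => ‖y - b‖ ^ 2) (cscg (c, σ)) := by
  rw [cscg_apply, integrable_map_measure (by fun_prop) (by fun_prop)]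
  refine (memLp_two_iff_integrable_sq_norm (by fun_prop)).mp ?_
  exact ((memLp_const c).add (memLp_two_id_stdCSCG.const_mul (σ : ℂ))).sub (memLp_const b)

lemma integral_norm_sub_sq_cscg (c b : ℂ) (σ : ℝ) :
    ∫ y, ‖y - b‖ ^ 2 ∂(cscg (c, σ)) = σ ^ 2 + ‖c - b‖ ^ 2 := by
  have hid : Integrable (fun z : ℂ => z) stdCSCG := memLp_two_id_stdCSCG.integrable (by norm_num)
  have hinner : ∫ z, inner ℝ (c - b) z ∂stdCSCG = 0 := by
    rw [integral_inner hid, integral_id_stdCSCG, inner_zero_right]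
  have hexpand (z : ℂ) : ‖c + σ * z - b‖ ^ 2
      = ‖c - b‖ ^ 2 + 2 * σ * inner ℝ (c - b) z + σ ^ 2 * ‖z‖ ^ 2 := by
    rw [add_sub_right_comm, ← Complex.real_smul, norm_add_sq_real, inner_smul_right, norm_smul,
      mul_pow, Real.norm_eq_abs, sq_abs]
    ring
  have hcross : Integrable (fun z : ℂ => 2 * σ * inner ℝ (c - b) z) stdCSCG :=
    (hid.const_inner _).const_mul _
  have hlin : Integrable (fun z : ℂ => ‖c - b‖ ^ 2 + 2 * σ * inner ℝ (c - b) z) stdCSCG :=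
    (integrable_const _).add hcross
  rw [cscg_apply, integral_map (by fun_prop) (by fun_prop)]
  simp_rw [hexpand]
  rw [integral_add hlin (integrable_norm_sq_stdCSCG.const_mul _),
    integral_add (integrable_const _) hcross, integral_const_mul, integral_const_mul, hinner,
    integral_norm_sq_stdCSCG]
  simp [add_comm]

/-- The density of `CN(c, σ²)` for `σ ≠ 0`. -/
noncomputable def cscgPDFReal (c : ℂ) (σ : ℝ) (y : ℂ) : ℝ :=
  (Real.pi * σ ^ 2)⁻¹ * Real.exp (-‖y - c‖ ^ 2 / σ ^ 2)

lemma cscgPDFReal_pos (c : ℂ) {σ : ℝ} (hσ : σ ≠ 0) (y : ℂ) : 0 < cscgPDFReal c σ y := by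
  unfold cscgPDFReal
  positivity

lemma measurable_cscgPDFReal (c : ℂ) (σ : ℝ) : Measurable (cscgPDFReal c σ) := by
  unfold cscgPDFReal
  fun_prop

lemma cscg_eq_withDensity (c : ℂ) {σ : ℝ} (hσ : σ ≠ 0) :
    cscg (c, σ) = volume.withDensity fun y => ENNReal.ofReal (cscgPDFReal c σ y) := by
  have hdens := measurable_cscgPDFReal c σ
  have hscale : Measurable fun z : ℂ => σ • z := by fun_prop
  refine Measure.ext_of_lintegral _ fun f hf => ?_
  have hvol (g : ℂ → ℝ≥0∞) (hg : Measurable g) :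
      ∫⁻ y, g y = ENNReal.ofReal (σ ^ 2) * ∫⁻ z : ℂ, g (c + σ • z) := by
    rw [← lintegral_add_left_eq_self g c, ← lintegral_map (f := fun z => g (c + z)) (by fun_prop)
      hscale, Measure.map_addHaar_smul _ hσ, lintegral_smul_measure, smul_eq_mul, ← mul_assoc,
      ← ENNReal.ofReal_mul (by positivity), Complex.finrank_real_complex,
      abs_of_nonneg (by positivity), mul_inv_cancel₀ (by positivity), ENNReal.ofReal_one, one_mul]
  rw [cscg_apply, lintegral_map hf (by fun_prop), stdCSCG,
    lintegral_withDensity_eq_lintegral_mul _ (by fun_prop) (by fun_prop),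
    lintegral_withDensity_eq_lintegral_mul _ (by fun_prop) hf,
    hvol ((fun y => ENNReal.ofReal (cscgPDFReal c σ y)) * f) (by fun_prop),
    ← lintegral_const_mul _ (by fun_prop)]
  refine lintegral_congr fun z => ?_
  simp only [Pi.mul_apply, cscgPDFReal, Complex.real_smul]
  rw [← mul_assoc, ← ENNReal.ofReal_mul (by positivity), add_sub_cancel_left, norm_mul, mul_pow,
    Complex.norm_real, Real.norm_eq_abs, sq_abs]
  field_simp

lemma log_cscgPDFReal_div (c₁ c₂ : ℂ) {σ₁ σ₂ : ℝ} (h₁ : σ₁ ≠ 0) (h₂ : σ₂ ≠ 0) (y : ℂ) :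
    Real.log (cscgPDFReal c₁ σ₁ y / cscgPDFReal c₂ σ₂ y)
      = Real.log (σ₂ ^ 2 / σ₁ ^ 2) - ‖y - c₁‖ ^ 2 / σ₁ ^ 2 + ‖y - c₂‖ ^ 2 / σ₂ ^ 2 := by
  have hquot : cscgPDFReal c₁ σ₁ y / cscgPDFReal c₂ σ₂ y = σ₂ ^ 2 / σ₁ ^ 2
      * Real.exp (-‖y - c₁‖ ^ 2 / σ₁ ^ 2 - -‖y - c₂‖ ^ 2 / σ₂ ^ 2) := by
    rw [Real.exp_sub, cscgPDFReal, cscgPDFReal]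
    field_simp
  rw [hquot, Real.log_mul (by positivity) (by positivity), Real.log_exp]
  ring

lemma absolutelyContinuous_cscg (c₁ c₂ : ℂ) {σ₁ σ₂ : ℝ} (h₁ : σ₁ ≠ 0) (h₂ : σ₂ ≠ 0) :
    cscg (c₁, σ₁) ≪ cscg (c₂, σ₂) := by
  rw [cscg_eq_withDensity c₁ h₁, cscg_eq_withDensity c₂ h₂]
  refine (withDensity_absolutelyContinuous _ _).trans
    (withDensity_absolutelyContinuous' (by have := measurable_cscgPDFReal c₂ σ₂; fun_prop) ?_)
  exact Filter.Eventually.of_forall fun y => by simpa using cscgPDFReal_pos c₂ h₂ y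

lemma llr_cscg_ae_eq (c₁ c₂ : ℂ) {σ₁ σ₂ : ℝ} (h₁ : σ₁ ≠ 0) (h₂ : σ₂ ≠ 0) :
    llr (cscg (c₁, σ₁)) (cscg (c₂, σ₂)) =ᵐ[cscg (c₁, σ₁)] fun y =>
      Real.log (σ₂ ^ 2 / σ₁ ^ 2) - ‖y - c₁‖ ^ 2 / σ₁ ^ 2 + ‖y - c₂‖ ^ 2 / σ₂ ^ 2 := by
  have hm₁ := measurable_cscgPDFReal c₁ σ₁
  have hm₂ := measurable_cscgPDFReal c₂ σ₂
  have hratio : cscg (c₁, σ₁) = (cscg (c₂, σ₂)).withDensity fun y =>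
      ENNReal.ofReal (cscgPDFReal c₁ σ₁ y / cscgPDFReal c₂ σ₂ y) := by
    rw [cscg_eq_withDensity c₁ h₁, cscg_eq_withDensity c₂ h₂,
      ← withDensity_mul _ (by fun_prop) (by fun_prop)]
    congr 1 with y
    rw [Pi.mul_apply, ← ENNReal.ofReal_mul (cscgPDFReal_pos c₂ h₂ y).le,
      mul_div_cancel₀ _ (cscgPDFReal_pos c₂ h₂ y).ne']
  have hrn : (cscg (c₁, σ₁)).rnDeriv (cscg (c₂, σ₂)) =ᵐ[cscg (c₂, σ₂)] fun y =>
      ENNReal.ofReal (cscgPDFReal c₁ σ₁ y / cscgPDFReal c₂ σ₂ y) := by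
    nth_rw 1 [hratio]
    exact Measure.rnDeriv_withDensity _ (by fun_prop)
  filter_upwards [(absolutelyContinuous_cscg c₁ c₂ h₁ h₂).ae_le hrn] with y hy
  rw [llr, hy, ENNReal.toReal_ofReal
    (div_pos (cscgPDFReal_pos c₁ h₁ y) (cscgPDFReal_pos c₂ h₂ y)).le,
    log_cscgPDFReal_div c₁ c₂ h₁ h₂]

lemma klDiv_cscg (c₁ c₂ : ℂ) {σ₁ σ₂ : ℝ} (h₁ : σ₁ ≠ 0) (h₂ : σ₂ ≠ 0) :
    klDiv (cscg (c₁, σ₁)) (cscg (c₂, σ₂)) = ENNReal.ofReal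
      (Real.log (σ₂ ^ 2 / σ₁ ^ 2) - 1 + (σ₁ ^ 2 + ‖c₁ - c₂‖ ^ 2) / σ₂ ^ 2) := by
  have hllr := llr_cscg_ae_eq c₁ c₂ h₁ h₂
  have hint (c : ℂ) (σ : ℝ) : Integrable (fun y => ‖y - c‖ ^ 2 / σ ^ 2) (cscg (c₁, σ₁)) :=
    (integrable_norm_sub_sq_cscg c₁ c σ₁).div_const _
  have hint₁ : Integrable (fun y => Real.log (σ₂ ^ 2 / σ₁ ^ 2) - ‖y - c₁‖ ^ 2 / σ₁ ^ 2)
      (cscg (c₁, σ₁)) := (integrable_const _).sub (hint c₁ σ₁)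
  rw [klDiv_of_ac_of_integrable (absolutelyContinuous_cscg c₁ c₂ h₁ h₂)
    ((hint₁.add (hint c₂ σ₂)).congr hllr.symm), integral_congr_ae hllr,
    integral_add hint₁ (hint c₂ σ₂), integral_sub (integrable_const _) (hint c₁ σ₁),
    integral_div, integral_div, integral_norm_sub_sq_cscg, integral_norm_sub_sq_cscg]
  simp [div_self (pow_ne_zero 2 h₁)]

end Gaussian
namespace AdaptiveSymbol

variable {𝓢T : Type v} {𝓢R : Type w} [MeasurableSpace 𝓢T] [MeasurableSpace 𝓢R]
  (A : AdaptiveSymbol.{u, v} 𝓢T) (Q : Measure (ℂ × 𝓢T × 𝓢R))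

/-- The second moment `E|X_A(s)|²` of the channel input given the CSIT `S_T = s`. -/
noncomputable def condPower (s : 𝓢T) : ℝ≥0∞ := ∫⁻ a, ‖A.input a s‖ₑ ^ 2 ∂A.law

/-- The power control policy induced by an adaptive symbol, `P(s) = E|X_A(s)|²` (and `0` where this
second moment is infinite). -/
noncomputable def policy (s : 𝓢T) : ℝ≥0 := (A.condPower s).toNNReal

lemma measurable_condPower : Measurable A.condPower :=
  Measurable.lintegral_prod_left' (f := fun x => ‖Function.uncurry A.input x‖ₑ ^ 2)
    (A.measurable_input.enorm.pow_const 2)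

lemma measurable_policy : Measurable A.policy := A.measurable_condPower.ennreal_toNNReal

lemma measurable_input_comp {α : Type*} [MeasurableSpace α] {f : α → A.Alphabet} {g : α → 𝓢T}
    (hf : Measurable f) (hg : Measurable g) : Measurable fun x => A.input (f x) (g x) :=
  A.measurable_input.comp (hf.prodMk hg)

lemma measurable_symbol : Measurable (A.symbol (𝓢R := 𝓢R)) := measurable_fst

lemma measurable_X : Measurable (A.X (𝓢R := 𝓢R)) :=
  A.measurable_input_comp (by fun_prop) (by fun_prop)

lemma measurable_Y : Measurable (A.Y (𝓢R := 𝓢R)) := by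
  have := A.measurable_X (𝓢R := 𝓢R)
  unfold Y
  fun_prop

lemma power_eq_lintegral_condPower [SFinite Q] : A.power Q = ∫⁻ ω, A.condPower ω.2.1 ∂Q := by
  have hX := A.measurable_X (𝓢R := 𝓢R)
  have hcond := A.measurable_condPower
  calc A.power Q = ∫⁻ x : (ℂ × 𝓢T × 𝓢R) × ℂ, A.condPower x.1.2.1 ∂(Q.prod stdCSCG) :=
        lintegral_prod_symm _ (hX.enorm.pow_const 2).aemeasurable
    _ = ∫⁻ ω, A.condPower ω.2.1 ∂Q := by
        rw [lintegral_prod _ (by fun_prop)]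
        simp only [lintegral_const, measure_univ, mul_one]

variable {Q}

lemma policy_mem_powerPolicies [SFinite Q] {P : ℝ≥0} (hA : A.power Q ≤ P) :
    A.policy ∈ powerPolicies Q P := by
  rw [power_eq_lintegral_condPower] at hA
  exact ⟨A.measurable_policy,
    (lintegral_mono fun ω => ENNReal.coe_toNNReal_le_self).trans hA⟩

lemma coe_policy_ae_eq [SFinite Q] (hA : A.power Q ≠ ∞) :
    ∀ᵐ ω ∂Q, (A.policy ω.2.1 : ℝ≥0∞) = A.condPower ω.2.1 := by
  have hcond := A.measurable_condPower
  rw [power_eq_lintegral_condPower] at hA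
  filter_upwards [ae_lt_top (f := fun ω : ℂ × 𝓢T × 𝓢R => A.condPower ω.2.1) (by fun_prop) hA]
    with ω hω using ENNReal.coe_toNNReal hω.ne

variable (𝓢R) in
/-- The law `CN(h X_a(s), 1)` of the channel output given the adaptive symbol `a` and the channel
state `(h, s, r)`. -/
noncomputable def outputKernel : Kernel (A.Alphabet × ℂ × 𝓢T × 𝓢R) ℂ :=
  cscg.comap (fun x => (x.2.1 * A.input x.1 x.2.2.1, 1)) (by
    have := A.measurable_input_comp (α := A.Alphabet × ℂ × 𝓢T × 𝓢R) (f := fun x => x.1)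
      (g := fun x => x.2.2.1) (by fun_prop) (by fun_prop)
    fun_prop)

variable (𝓢R) in
/-- The law `CN(0, 1 + |h|² P(s))` given the channel state `(h, s, r)`, where `P(·)` is the policy
of `A`: it has the second moment of the channel output, and is the reference output law in the
bound on the mutual information. -/
noncomputable def gaussianOutputKernel : Kernel (ℂ × 𝓢T × 𝓢R) ℂ :=
  cscg.comap (fun ω => (0, √(1 + ‖ω.1‖ ^ 2 * A.policy ω.2.1))) (by
    have := A.measurable_policy
    fun_prop)

instance : IsMarkovKernel (A.outputKernel 𝓢R) := by unfold outputKernel; infer_instance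

instance : IsMarkovKernel (A.gaussianOutputKernel 𝓢R) := by
  unfold gaussianOutputKernel; infer_instance

lemma map_jointLaw_eq_compProd_outputKernel [SFinite Q] :
    (A.jointLaw Q).map (fun ω => ((A.symbol ω, ω.2.1), A.Y ω))
      = (A.law.prod Q) ⊗ₘ A.outputKernel 𝓢R := by
  have hY := A.measurable_Y (𝓢R := 𝓢R)
  have hsymbol := A.measurable_symbol (𝓢R := 𝓢R)
  have houtput (x : A.Alphabet × ℂ × 𝓢T × 𝓢R) :
      A.outputKernel 𝓢R x = stdCSCG.map fun z => x.2.1 * A.input x.1 x.2.2.1 + z := by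
    rw [outputKernel, Kernel.comap_apply, cscg_apply]
    simp only [Complex.ofReal_one, one_mul]
  refine Measure.ext_of_lintegral _ fun f hf => ?_
  rw [lintegral_map hf (by fun_prop), Measure.lintegral_compProd hf,
    lintegral_prod _ (by fun_prop),
    lintegral_prod _ (hf.lintegral_kernel_prod_right' (κ := A.outputKernel 𝓢R)).aemeasurable]
  refine lintegral_congr fun a => ?_
  rw [lintegral_prod _ (by unfold symbol; fun_prop)]
  refine lintegral_congr fun ω => ?_
  rw [houtput, lintegral_map (by fun_prop) (by fun_prop)]
  rfl

lemma klDiv_outputKernel_gaussianOutputKernel (x : A.Alphabet × ℂ × 𝓢T × 𝓢R) :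
    klDiv (A.outputKernel 𝓢R x) (A.gaussianOutputKernel 𝓢R x.2)
      = ENNReal.ofReal (Real.log (1 + ‖x.2.1‖ ^ 2 * A.policy x.2.2.1) - 1
        + (1 + ‖x.2.1‖ ^ 2 * ‖A.input x.1 x.2.2.1‖ ^ 2)
          / (1 + ‖x.2.1‖ ^ 2 * A.policy x.2.2.1)) := by
  have hvar : 0 < 1 + ‖x.2.1‖ ^ 2 * (A.policy x.2.2.1 : ℝ) := by positivity
  rw [outputKernel, gaussianOutputKernel, Kernel.comap_apply, Kernel.comap_apply,
    klDiv_cscg _ _ one_ne_zero (Real.sqrt_pos.mpr hvar).ne', Real.sq_sqrt hvar.le]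
  simp only [one_pow, div_one, sub_zero, norm_mul, mul_pow]

lemma lintegral_klDiv_outputKernel {ω : ℂ × 𝓢T × 𝓢R}
    (hω : (A.policy ω.2.1 : ℝ≥0∞) = A.condPower ω.2.1) :
    ∫⁻ a, klDiv (A.outputKernel 𝓢R (a, ω)) (A.gaussianOutputKernel 𝓢R ω) ∂A.law
      = ENNReal.ofReal (Real.log (1 + ‖ω.1‖ ^ 2 * A.policy ω.2.1)) := by
  set var : ℝ := 1 + ‖ω.1‖ ^ 2 * A.policy ω.2.1
  have hvar_pos : 0 < var := by positivity
  have hlog : 0 ≤ Real.log var - 1 + var⁻¹ := by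
    linarith [Real.one_sub_inv_le_log_of_pos hvar_pos]
  have hsplit (x : ℂ) :
      ENNReal.ofReal (Real.log var - 1 + (1 + ‖ω.1‖ ^ 2 * ‖x‖ ^ 2) / var)
        = ENNReal.ofReal (Real.log var - 1 + var⁻¹)
          + ENNReal.ofReal (‖ω.1‖ ^ 2 / var) * ‖x‖ₑ ^ 2 := by
    rw [← ofReal_norm, ← ENNReal.ofReal_pow (norm_nonneg _),
      ← ENNReal.ofReal_mul (by positivity), ← ENNReal.ofReal_add hlog (by positivity)]
    ring_nf
  have hinput : Measurable fun a => ‖A.input a ω.2.1‖ₑ ^ 2 :=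
    (A.measurable_input_comp measurable_id measurable_const).enorm.pow_const 2
  have hkl (a : A.Alphabet) : klDiv (A.outputKernel 𝓢R (a, ω)) (A.gaussianOutputKernel 𝓢R ω)
      = ENNReal.ofReal (Real.log var - 1 + var⁻¹)
        + ENNReal.ofReal (‖ω.1‖ ^ 2 / var) * ‖A.input a ω.2.1‖ₑ ^ 2 :=
    (A.klDiv_outputKernel_gaussianOutputKernel (a, ω)).trans (hsplit _)
  simp_rw [hkl]
  rw [lintegral_add_left measurable_const, lintegral_const, measure_univ, mul_one,
    lintegral_const_mul _ hinput, ← condPower, ← hω, ← ENNReal.ofReal_coe_nnreal,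
    ← ENNReal.ofReal_mul (by positivity), ← ENNReal.ofReal_add hlog (by positivity)]
  congr 1
  field_simp
  linarith

lemma measurable_klDiv_outputKernel :
    Measurable fun x : A.Alphabet × ℂ × 𝓢T × 𝓢R =>
      klDiv (A.outputKernel 𝓢R x) (A.gaussianOutputKernel 𝓢R x.2) := by
  have hinput := A.measurable_input_comp (α := A.Alphabet × ℂ × 𝓢T × 𝓢R) (f := fun x => x.1)
    (g := fun x => x.2.2.1) (by fun_prop) (by fun_prop)
  have hpolicy := A.measurable_policy
  simp_rw [klDiv_outputKernel_gaussianOutputKernel]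
  fun_prop

lemma outputKernel_absolutelyContinuous (x : A.Alphabet × ℂ × 𝓢T × 𝓢R) :
    A.outputKernel 𝓢R x ≪ A.gaussianOutputKernel 𝓢R x.2 :=
  absolutelyContinuous_cscg _ _ one_ne_zero (Real.sqrt_pos.mpr (by positivity)).ne'

lemma condMutualInfo_le_policyRate [IsProbabilityMeasure Q] (hA : A.power Q ≠ ∞) :
    condMutualInfo (A.jointLaw Q) A.symbol A.Y A.csir ≤ policyRate Q A.policy := by
  have hindep : IndepFun A.symbol (fun ω : A.Sample 𝓢R => ω.2.1) (A.jointLaw Q) :=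
    indepFun_prod measurable_id measurable_fst
  have hsymbol : (A.jointLaw Q).map A.symbol = A.law := Measure.fst_prod
  have hstate : (A.jointLaw Q).map (fun ω => ω.2.1) = Q := by
    have hcomp : (A.jointLaw Q).map (fun ω => ω.2.1) = (A.jointLaw Q).snd.fst :=
      (Measure.map_map measurable_fst measurable_snd).symm
    rw [hcomp, Measure.snd_prod, Measure.fst_prod]
  calc condMutualInfo (A.jointLaw Q) A.symbol A.Y A.csir
      ≤ klDiv ((A.law.prod Q) ⊗ₘ A.outputKernel 𝓢R)
          ((A.law.prod Q) ⊗ₘ Kernel.prodMkLeft A.Alphabet (A.gaussianOutputKernel 𝓢R)) := by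
        have hgolden := condMutualInfo_comp_le_klDiv_of_indepFun (g := fun w => w.2.2)
          A.measurable_symbol A.measurable_Y (by fun_prop) (by fun_prop) hindep
          (A.gaussianOutputKernel 𝓢R)
        rwa [hsymbol, hstate, map_jointLaw_eq_compProd_outputKernel] at hgolden
    _ = ∫⁻ ω, ∫⁻ a, klDiv (A.outputKernel 𝓢R (a, ω)) (A.gaussianOutputKernel 𝓢R ω)
          ∂A.law ∂Q := by
        rw [klDiv_compProd_right _ (Filter.Eventually.of_forall
          A.outputKernel_absolutelyContinuous)]
        exact lintegral_prod_symm _ A.measurable_klDiv_outputKernel.aemeasurable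
    _ = policyRate Q A.policy := by
        refine lintegral_congr_ae ?_
        filter_upwards [A.coe_policy_ae_eq hA] with ω hω using A.lintegral_klDiv_outputKernel hω

end AdaptiveSymbol

open Filter Topology

section LogMeanGap

/-- The amount by which the logarithm of the arithmetic mean of `a` and `b` exceeds the mean of
their logarithms, as a function of `x = log a - log b`. It quantifies the strict concavity of the
logarithm. -/
noncomputable def logMeanGap (x : ℝ) : ℝ := Real.log (Real.cosh (x / 2))

lemma log_half_add {a b : ℝ} (ha : 0 < a) (hb : 0 < b) :
    Real.log ((a + b) / 2)
      = (Real.log a + Real.log b) / 2 + logMeanGap (Real.log a - Real.log b) := by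
  obtain ⟨x, rfl⟩ : ∃ x, Real.exp x = a := ⟨_, Real.exp_log ha⟩
  obtain ⟨y, rfl⟩ : ∃ y, Real.exp y = b := ⟨_, Real.exp_log hb⟩
  have hmean : (Real.exp x + Real.exp y) / 2
      = Real.exp ((x + y) / 2) * Real.cosh ((x - y) / 2) := by
    rw [Real.cosh_eq, mul_div_assoc', mul_add, ← Real.exp_add, ← Real.exp_add]
    ring_nf
  rw [hmean, Real.log_mul (Real.exp_pos _).ne' (Real.cosh_pos _).ne']
  simp only [Real.log_exp, logMeanGap]

lemma logMeanGap_nonneg (x : ℝ) : 0 ≤ logMeanGap x := Real.log_nonneg (Real.one_le_cosh _)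

lemma logMeanGap_lt_logMeanGap {x y : ℝ} : logMeanGap x < logMeanGap y ↔ |x| < |y| := by
  rw [logMeanGap, logMeanGap, Real.log_lt_log_iff (Real.cosh_pos _) (Real.cosh_pos _),
    Real.cosh_lt_cosh, abs_div, abs_div, div_lt_div_iff_of_pos_right (by positivity)]

lemma logMeanGap_le_logMeanGap {x y : ℝ} : logMeanGap x ≤ logMeanGap y ↔ |x| ≤ |y| := by
  rw [← not_lt, logMeanGap_lt_logMeanGap, not_lt]

lemma logMeanGap_pos {x : ℝ} (hx : x ≠ 0) : 0 < logMeanGap x :=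
  Real.log_pos (Real.one_lt_cosh.mpr (by positivity))

lemma measurable_logMeanGap : Measurable logMeanGap :=
  Real.measurable_log.comp (Real.continuous_cosh.measurable.comp (measurable_id.div_const 2))

variable {Ω : Type*} [MeasurableSpace Ω] {μ : Measure Ω}

lemma ae_eventually_lt_of_lintegral_le {f : ℕ → Ω → ℝ≥0∞} (hf : ∀ k, AEMeasurable (f k) μ)
    {c ε : ℕ → ℝ≥0∞} (hc : ∀ k, c k ≠ 0) (hc' : ∀ k, c k ≠ ∞) (hε : ∑' k, ε k ≠ ∞)
    (h : ∀ k, ∫⁻ ω, f k ω ∂μ ≤ c k * ε k) : ∀ᵐ ω ∂μ, ∀ᶠ k in atTop, f k ω < c k := by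
  have hmarkov (k : ℕ) : μ {ω | c k ≤ f k ω} ≤ ε k :=
    calc μ {ω | c k ≤ f k ω} ≤ (∫⁻ ω, f k ω ∂μ) / c k :=
          meas_ge_le_lintegral_div (hf k) (hc k) (hc' k)
      _ ≤ ε k := ENNReal.div_le_of_le_mul' (h k)
  filter_upwards [ae_eventually_notMem (ne_top_of_le_ne_top hε (ENNReal.tsum_le_tsum hmarkov))]
    with ω hω
  filter_upwards [hω] with k hk using not_le.mp hk

/-- The tolerance `2⁻ᵏ logMeanGap 2⁻ᵏ`: by Markov's inequality, if the integral of
`logMeanGap (f - g)` is at most this, then `2⁻ᵏ ≤ |f - g|` only on a set of measure at most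
`2⁻ᵏ`. -/
noncomputable def gapTolerance (k : ℕ) : ℝ≥0∞ :=
  ENNReal.ofReal (logMeanGap ((1 / 2) ^ k)) * 2⁻¹ ^ k

lemma gapTolerance_ne_zero (k : ℕ) : gapTolerance k ≠ 0 :=
  mul_ne_zero (ENNReal.ofReal_pos.mpr (logMeanGap_pos (by positivity))).ne'
    (pow_ne_zero k (ENNReal.inv_ne_zero.mpr ENNReal.ofNat_ne_top))

lemma antitone_gapTolerance : Antitone gapTolerance := by
  intro j k hjk
  have hpow : ((1 : ℝ) / 2) ^ k ≤ (1 / 2) ^ j :=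
    pow_le_pow_of_le_one (by norm_num) (by norm_num) hjk
  refine mul_le_mul' (ENNReal.ofReal_le_ofReal (logMeanGap_le_logMeanGap.mpr ?_))
    (pow_le_pow_right_of_le_one' (by simp) hjk)
  rwa [abs_of_pos (by positivity), abs_of_pos (by positivity)]

lemma tendsto_gapTolerance : Tendsto gapTolerance atTop (𝓝 0) := by
  have hbound : Tendsto (fun k : ℕ => ENNReal.ofReal (logMeanGap 1) * 2⁻¹ ^ k) atTop (𝓝 0) := by
    simpa using ENNReal.Tendsto.const_mul
      (ENNReal.tendsto_pow_atTop_nhds_zero_of_lt_one (ENNReal.inv_lt_one.mpr ENNReal.one_lt_two))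
      (.inr ENNReal.ofReal_ne_top)
  refine tendsto_of_tendsto_of_tendsto_of_le_of_le tendsto_const_nhds hbound
    (fun _ => zero_le) fun k => ?_
  refine mul_le_mul_left (ENNReal.ofReal_le_ofReal (logMeanGap_le_logMeanGap.mpr ?_)) _
  rw [abs_of_pos (by positivity), abs_one]
  exact pow_le_one₀ (by norm_num) (by norm_num)

lemma ae_exists_tendsto_of_lintegral_logMeanGap_le {r : ℕ → Ω → ℝ} (hr : ∀ k, Measurable (r k))
    (h : ∀ k, ∫⁻ ω, ENNReal.ofReal (logMeanGap (r k ω - r (k + 1) ω)) ∂μ ≤ gapTolerance k) :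
    ∀ᵐ ω ∂μ, ∃ l, Tendsto (fun k => r k ω) atTop (𝓝 l) := by
  have hpos (k : ℕ) : 0 < logMeanGap ((1 / 2) ^ k) := logMeanGap_pos (by positivity)
  have hlt := ae_eventually_lt_of_lintegral_le
    (fun k => (measurable_logMeanGap.comp ((hr k).sub (hr (k + 1)))).ennreal_ofReal.aemeasurable)
    (fun k => (ENNReal.ofReal_pos.mpr (hpos k)).ne') (fun _ => ENNReal.ofReal_ne_top)
    (by simp [ENNReal.tsum_geometric]) h
  filter_upwards [hlt] with ω hω
  refine cauchySeq_tendsto_of_complete (cauchySeq_of_summable_dist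
    (Summable.of_norm_bounded_eventually_nat summable_geometric_two ?_))
  filter_upwards [hω] with k hk
  have habs := logMeanGap_lt_logMeanGap.mp ((ENNReal.ofReal_lt_ofReal_iff (hpos k)).mp hk)
  rw [abs_of_pos (by positivity : (0 : ℝ) < (1 / 2) ^ k)] at habs
  rw [Real.norm_of_nonneg dist_nonneg, Real.dist_eq]
  exact habs.le

end LogMeanGap

section OptimalPolicy

variable {𝓢T : Type v} {𝓢R : Type w}

/-- The rate `log (1 + G P(S_T))` as a function of the channel state. -/
noncomputable def logRate (p : 𝓢T → ℝ≥0) (ω : ℂ × 𝓢T × 𝓢R) : ℝ :=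
  Real.log (1 + ‖ω.1‖ ^ 2 * (p ω.2.1 : ℝ))

lemma logRate_nonneg (p : 𝓢T → ℝ≥0) (ω : ℂ × 𝓢T × 𝓢R) : 0 ≤ logRate p ω :=
  Real.log_nonneg (le_add_of_nonneg_right (by positivity))

lemma logRate_midpoint (p q : 𝓢T → ℝ≥0) (ω : ℂ × 𝓢T × 𝓢R) :
    logRate (fun s => (p s + q s) / 2) ω
      = (logRate p ω + logRate q ω) / 2 + logMeanGap (logRate p ω - logRate q ω) := by
  simp only [logRate]
  rw [← log_half_add (by positivity) (by positivity)]
  push_cast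
  ring_nf

/-- The pointwise lower limit of a sequence of power policies (`0` where it is infinite). -/
noncomputable def liminfPolicy (p : ℕ → 𝓢T → ℝ≥0) (s : 𝓢T) : ℝ≥0 :=
  (liminf (fun k => (p k s : ℝ≥0∞)) atTop).toNNReal

lemma tendsto_logRate_liminfPolicy {p : ℕ → 𝓢T → ℝ≥0} {ω : ℂ × 𝓢T × 𝓢R} {l : ℝ}
    (h : Tendsto (fun k => logRate (p k) ω) atTop (𝓝 l)) :
    Tendsto (fun k => logRate (p k) ω) atTop (𝓝 (logRate (liminfPolicy p) ω)) := by
  by_cases hgain : ω.1 = 0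
  · simp [logRate, hgain]
  have hpolicy (k : ℕ) : (p k ω.2.1 : ℝ) = (Real.exp (logRate (p k) ω) - 1) / ‖ω.1‖ ^ 2 := by
    rw [logRate, Real.exp_log (by positivity)]
    field_simp
    ring
  have hlim : Tendsto (fun k => (p k ω.2.1 : ℝ)) atTop (𝓝 ((Real.exp l - 1) / ‖ω.1‖ ^ 2)) := by
    simp_rw [hpolicy]
    exact (h.rexp.sub_const 1).div_const _
  lift (Real.exp l - 1) / ‖ω.1‖ ^ 2 to ℝ≥0
    using ge_of_tendsto' hlim fun k => NNReal.coe_nonneg _ with c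
  have hval : liminfPolicy p ω.2.1 = c := by
    rw [liminfPolicy, (ENNReal.tendsto_coe.mpr (NNReal.tendsto_coe.mp hlim)).liminf_eq,
      ENNReal.toNNReal_coe]
  unfold logRate
  rw [hval]
  exact ((hlim.const_mul _).const_add 1).log (by positivity)

lemma log_one_add_mul_le {g x ε : ℝ} (hg : 0 ≤ g) (hx : 0 ≤ x) (hε : 0 < ε) (hε' : ε ≤ 1) :
    Real.log (1 + g * x) ≤ Real.log (1 + g) - Real.log ε + ε * x := by
  calc Real.log (1 + g * x) ≤ Real.log ((1 + g) * (1 + x)) :=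
        Real.log_le_log (by positivity) (by linarith)
    _ = Real.log (1 + g) - Real.log ε + Real.log (ε * (1 + x)) := by
        rw [Real.log_mul (by positivity) (by positivity), Real.log_mul hε.ne' (by positivity)]
        ring
    _ ≤ Real.log (1 + g) - Real.log ε + ε * x := by
        linarith [Real.log_le_sub_one_of_pos (show 0 < ε * (1 + x) by positivity)]

variable [MeasurableSpace 𝓢T] [MeasurableSpace 𝓢R]

lemma measurable_logRate {p : 𝓢T → ℝ≥0} (hp : Measurable p) :
    Measurable (logRate p : ℂ × 𝓢T × 𝓢R → ℝ) := by
  unfold logRate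
  fun_prop

variable {Q : Measure (ℂ × 𝓢T × 𝓢R)} {P : ℝ≥0}

lemma midpoint_mem_powerPolicies {p q : 𝓢T → ℝ≥0} (hp : p ∈ powerPolicies Q P)
    (hq : q ∈ powerPolicies Q P) : (fun s => (p s + q s) / 2) ∈ powerPolicies Q P := by
  have hpm : Measurable p := hp.1
  have hqm : Measurable q := hq.1
  refine ⟨by fun_prop, ?_⟩
  have hcoe (s : 𝓢T) :
      (((p s + q s) / 2 : ℝ≥0) : ℝ≥0∞) = ((p s : ℝ≥0∞) + q s) * 2⁻¹ := by
    rw [ENNReal.coe_div two_ne_zero, ENNReal.coe_add, ENNReal.coe_ofNat, div_eq_mul_inv]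
  simp_rw [hcoe]
  rw [lintegral_mul_const _ (by fun_prop), lintegral_add_left (by fun_prop), ← div_eq_mul_inv]
  refine ENNReal.div_le_of_le_mul ?_
  rw [mul_two]
  exact add_le_add hp.2 hq.2

lemma policyRate_add_policyRate {p q : 𝓢T → ℝ≥0} (hp : Measurable p) (hq : Measurable q) :
    policyRate Q p + policyRate Q q
        + 2 * ∫⁻ ω, ENNReal.ofReal (logMeanGap (logRate p ω - logRate q ω)) ∂Q
      = 2 * policyRate Q (fun s => (p s + q s) / 2) := by
  have hrp := measurable_logRate (𝓢R := 𝓢R) hp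
  have hrq := measurable_logRate (𝓢R := 𝓢R) hq
  have hrm := measurable_logRate (𝓢R := 𝓢R) (p := fun s => (p s + q s) / 2) (by fun_prop)
  have hgap : Measurable fun ω : ℂ × 𝓢T × 𝓢R => logMeanGap (logRate p ω - logRate q ω) :=
    measurable_logMeanGap.comp (hrp.sub hrq)
  have hpointwise (ω : ℂ × 𝓢T × 𝓢R) : ENNReal.ofReal (logRate p ω) + ENNReal.ofReal (logRate q ω)
      + 2 * ENNReal.ofReal (logMeanGap (logRate p ω - logRate q ω))
      = 2 * ENNReal.ofReal (logRate (fun s => (p s + q s) / 2) ω) := by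
    rw [← ENNReal.ofReal_add (logRate_nonneg _ _) (logRate_nonneg _ _), ← ENNReal.ofReal_ofNat 2,
      ← ENNReal.ofReal_mul zero_le_two, ← ENNReal.ofReal_mul zero_le_two, ← ENNReal.ofReal_add
        (add_nonneg (logRate_nonneg _ _) (logRate_nonneg _ _))
        (mul_nonneg zero_le_two (logMeanGap_nonneg _)), logRate_midpoint]
    ring_nf
  calc _ = ∫⁻ ω, ENNReal.ofReal (logRate p ω) + ENNReal.ofReal (logRate q ω)
          + 2 * ENNReal.ofReal (logMeanGap (logRate p ω - logRate q ω)) ∂Q := by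
        rw [lintegral_add_left (by fun_prop), lintegral_add_left (by fun_prop),
          lintegral_const_mul _ hgap.ennreal_ofReal]
        rfl
    _ = _ := by
        simp_rw [hpointwise]
        exact lintegral_const_mul _ hrm.ennreal_ofReal

lemma lintegral_logMeanGap_le {M δ : ℝ≥0∞} (hM : M ≠ ∞)
    (hmax : ∀ q ∈ powerPolicies Q P, policyRate Q q ≤ M) {p q : 𝓢T → ℝ≥0}
    (hp : p ∈ powerPolicies Q P) (hq : q ∈ powerPolicies Q P)
    (hpM : M ≤ policyRate Q p + δ) (hqM : M ≤ policyRate Q q + δ) :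
    ∫⁻ ω, ENNReal.ofReal (logMeanGap (logRate p ω - logRate q ω)) ∂Q ≤ δ := by
  set gap := ∫⁻ ω, ENNReal.ofReal (logMeanGap (logRate p ω - logRate q ω)) ∂Q
  have hfin : policyRate Q p + policyRate Q q ≠ ∞ :=
    ENNReal.add_ne_top.mpr ⟨ne_top_of_le_ne_top hM (hmax p hp), ne_top_of_le_ne_top hM (hmax q hq)⟩
  refine (ENNReal.mul_le_mul_iff_right two_ne_zero ENNReal.ofNat_ne_top).mp
    ((ENNReal.add_le_add_iff_left hfin).mp ?_)
  calc policyRate Q p + policyRate Q q + 2 * gap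
      = 2 * policyRate Q (fun s => (p s + q s) / 2) := policyRate_add_policyRate hp.1 hq.1
    _ ≤ M + M := by
        rw [two_mul]
        exact add_le_add (hmax _ (midpoint_mem_powerPolicies hp hq))
          (hmax _ (midpoint_mem_powerPolicies hp hq))
    _ ≤ (policyRate Q p + δ) + (policyRate Q q + δ) := add_le_add hpM hqM
    _ = policyRate Q p + policyRate Q q + 2 * δ := by ring

lemma liminfPolicy_mem_powerPolicies {p : ℕ → 𝓢T → ℝ≥0} (hp : ∀ k, p k ∈ powerPolicies Q P) :
    liminfPolicy p ∈ powerPolicies Q P := by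
  have hmeas (k : ℕ) : Measurable fun s => (p k s : ℝ≥0∞) := (hp k).1.coe_nnreal_ennreal
  refine ⟨(Measurable.liminf hmeas).ennreal_toNNReal, ?_⟩
  calc _ ≤ ∫⁻ ω, liminf (fun k => (p k ω.2.1 : ℝ≥0∞)) atTop ∂Q :=
        lintegral_mono fun ω => ENNReal.coe_toNNReal_le_self
    _ ≤ liminf (fun k => ∫⁻ ω, (p k ω.2.1 : ℝ≥0∞) ∂Q) atTop :=
        lintegral_liminf_le fun k => (hmeas k).comp (by fun_prop)
    _ ≤ P := liminf_le_of_le (by isBoundedDefault) fun b hb => by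
        obtain ⟨k, hk⟩ := hb.exists
        exact hk.trans (hp k).2

/-- The loss from capping the rate is small uniformly in the policy, and the capped rates have an
integrable bound that does not depend on the policy. -/
lemma policyRate_le_lintegral_min_add {q : 𝓢T → ℝ≥0} (hq : q ∈ powerPolicies Q P) {ε : ℝ}
    (hε : 0 < ε) (hε' : ε ≤ 1) :
    policyRate Q q ≤ ∫⁻ ω, ENNReal.ofReal
        (min (logRate q ω) (Real.log (1 + ‖ω.1‖ ^ 2) - Real.log ε)) ∂Q
      + ENNReal.ofReal ε * P := by
  have hqm : Measurable q := hq.1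
  have hpointwise (ω : ℂ × 𝓢T × 𝓢R) : ENNReal.ofReal (logRate q ω) ≤ ENNReal.ofReal
        (min (logRate q ω) (Real.log (1 + ‖ω.1‖ ^ 2) - Real.log ε))
      + ENNReal.ofReal ε * q ω.2.1 := by
    rw [← ENNReal.ofReal_coe_nnreal, ← ENNReal.ofReal_mul hε.le]
    refine (ENNReal.ofReal_le_ofReal ?_).trans ENNReal.ofReal_add_le
    rw [← min_add_add_right]
    exact le_min (le_add_of_nonneg_right (by positivity))
      (log_one_add_mul_le (by positivity) (by positivity) hε hε')
  calc policyRate Q q ≤ _ := lintegral_mono hpointwise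
    _ = _ + ENNReal.ofReal ε * ∫⁻ ω, (q ω.2.1 : ℝ≥0∞) ∂Q := by
        rw [lintegral_add_right _ (by fun_prop), lintegral_const_mul _ (by fun_prop)]
    _ ≤ _ := by gcongr; exact hq.2

variable [IsFiniteMeasure Q]

lemma lintegral_log_sub_const_ne_top
    (hlog : ∫⁻ ω, ENNReal.ofReal (Real.log (1 + ‖ω.1‖ ^ 2)) ∂Q ≠ ∞) (c : ℝ) :
    ∫⁻ ω, ENNReal.ofReal (Real.log (1 + ‖ω.1‖ ^ 2) - c) ∂Q ≠ ∞ := by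
  refine ne_top_of_le_ne_top ?_ (lintegral_mono fun ω => ENNReal.ofReal_add_le (q := -c))
  rw [lintegral_add_right _ measurable_const, lintegral_const]
  exact ENNReal.add_ne_top.mpr ⟨hlog, ENNReal.mul_ne_top ENNReal.ofReal_ne_top (measure_ne_top _ _)⟩

lemma iSup_policyRate_ne_top
    (hlog : ∫⁻ ω, ENNReal.ofReal (Real.log (1 + ‖ω.1‖ ^ 2)) ∂Q ≠ ∞) (P : ℝ≥0) :
    ⨆ q ∈ powerPolicies Q P, policyRate Q q ≠ ∞ := by
  have hbound : ∀ q ∈ powerPolicies Q P, policyRate Q q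
      ≤ ∫⁻ ω, ENNReal.ofReal (Real.log (1 + ‖ω.1‖ ^ 2) - Real.log 1) ∂Q
        + ENNReal.ofReal 1 * P := fun q hq => by
    refine (policyRate_le_lintegral_min_add hq one_pos le_rfl).trans ?_
    gcongr
    exact min_le_right _ _
  exact ne_top_of_le_ne_top (ENNReal.add_ne_top.mpr
    ⟨lintegral_log_sub_const_ne_top hlog _, ENNReal.mul_ne_top ENNReal.ofReal_ne_top
      ENNReal.coe_ne_top⟩) (iSup₂_le hbound)

lemma tendsto_lintegral_min_logRate
    (hlog : ∫⁻ ω, ENNReal.ofReal (Real.log (1 + ‖ω.1‖ ^ 2)) ∂Q ≠ ∞)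
    {p : ℕ → 𝓢T → ℝ≥0} (hp : ∀ k, Measurable (p k))
    (hconv : ∀ᵐ ω ∂Q, ∃ l, Tendsto (fun k => logRate (p k) ω) atTop (𝓝 l)) (c : ℝ) :
    Tendsto
      (fun k => ∫⁻ ω, ENNReal.ofReal (min (logRate (p k) ω) (Real.log (1 + ‖ω.1‖ ^ 2) - c)) ∂Q)
      atTop (𝓝 (∫⁻ ω, ENNReal.ofReal
        (min (logRate (liminfPolicy p) ω) (Real.log (1 + ‖ω.1‖ ^ 2) - c)) ∂Q)) := by
  refine tendsto_lintegral_of_dominated_convergence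
    (fun ω => ENNReal.ofReal (Real.log (1 + ‖ω.1‖ ^ 2) - c)) (fun k => ?_)
    (fun k => Eventually.of_forall fun ω => ENNReal.ofReal_le_ofReal (min_le_right _ _))
    (lintegral_log_sub_const_ne_top hlog c) ?_
  · have hrate := measurable_logRate (𝓢R := 𝓢R) (hp k)
    fun_prop
  · filter_upwards [hconv] with ω ⟨l, hl⟩
    exact ENNReal.tendsto_ofReal ((tendsto_logRate_liminfPolicy hl).min tendsto_const_nhds)

lemma le_policyRate_liminfPolicy
    (hlog : ∫⁻ ω, ENNReal.ofReal (Real.log (1 + ‖ω.1‖ ^ 2)) ∂Q ≠ ∞)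
    {p : ℕ → 𝓢T → ℝ≥0} (hp : ∀ k, p k ∈ powerPolicies Q P)
    (hconv : ∀ᵐ ω ∂Q, ∃ l, Tendsto (fun k => logRate (p k) ω) atTop (𝓝 l))
    {M : ℝ≥0∞} {δ : ℕ → ℝ≥0∞} (hδ : Tendsto δ atTop (𝓝 0))
    (hM : ∀ k, M ≤ policyRate Q (p k) + δ k) : M ≤ policyRate Q (liminfPolicy p) := by
  have hcapped (ε : ℝ) (hε : 0 < ε) (hε' : ε ≤ 1) :
      M ≤ policyRate Q (liminfPolicy p) + ENNReal.ofReal ε * P := by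
    have hlim := tendsto_lintegral_min_logRate hlog (fun k => (hp k).1) hconv (Real.log ε)
    have hle := ge_of_tendsto' ((hlim.add_const (ENNReal.ofReal ε * P)).add hδ) fun k =>
      (hM k).trans (add_le_add_left (policyRate_le_lintegral_min_add (hp k) hε hε') (δ k))
    rw [add_zero] at hle
    refine hle.trans (add_le_add_left (lintegral_mono fun ω => ?_) _)
    exact ENNReal.ofReal_le_ofReal (min_le_left _ _)
  have hcont : Continuous fun ε : ℝ =>
      policyRate Q (liminfPolicy p) + ENNReal.ofReal ε * (P : ℝ≥0∞) :=
    continuous_const.add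
      ((ENNReal.continuous_mul_const ENNReal.coe_ne_top).comp ENNReal.continuous_ofReal)
  have hzero : Tendsto (fun ε : ℝ => policyRate Q (liminfPolicy p) + ENNReal.ofReal ε * P)
      (𝓝[>] 0) (𝓝 (policyRate Q (liminfPolicy p))) := by
    simpa using (hcont.tendsto 0).mono_left nhdsWithin_le_nhds
  refine ge_of_tendsto hzero ?_
  filter_upwards [Ioc_mem_nhdsGT one_pos] with ε hε using hcapped ε hε.1 hε.2

lemma exists_isMaxOn_policyRate
    (hlog : ∫⁻ ω, ENNReal.ofReal (Real.log (1 + ‖ω.1‖ ^ 2)) ∂Q ≠ ∞) (P : ℝ≥0) :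
    ∃ p ∈ powerPolicies Q P, IsMaxOn (policyRate Q) (powerPolicies Q P) p := by
  set M : ℝ≥0∞ := ⨆ q ∈ powerPolicies Q P, policyRate Q q
  have hM : M ≠ ∞ := iSup_policyRate_ne_top hlog P
  have hmax : ∀ q ∈ powerPolicies Q P, policyRate Q q ≤ M := fun q hq =>
    le_iSup₂ (f := fun q (_ : q ∈ powerPolicies Q P) => policyRate Q q) q hq
  have hzero : (fun _ => 0) ∈ powerPolicies Q P := ⟨measurable_const, by simp⟩
  have happrox (k : ℕ) : ∃ p ∈ powerPolicies Q P, M ≤ policyRate Q p + gapTolerance k := by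
    rcases eq_or_ne M 0 with h0 | h0
    · exact ⟨_, hzero, h0.trans_le zero_le⟩
    · obtain ⟨p, hp, hlt⟩ := lt_biSup_iff.mp (ENNReal.sub_lt_self hM h0 (gapTolerance_ne_zero k))
      exact ⟨p, hp, tsub_le_iff_right.mp hlt.le⟩
  choose p hp hpM using happrox
  refine ⟨liminfPolicy p, liminfPolicy_mem_powerPolicies hp, fun q hq => (hmax q hq).trans ?_⟩
  refine le_policyRate_liminfPolicy hlog hp (ae_exists_tendsto_of_lintegral_logMeanGap_le
    (fun k => measurable_logRate (hp k).1) fun k => ?_) tendsto_gapTolerance hpM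
  exact lintegral_logMeanGap_le hM hmax (hp k) (hp (k + 1)) (hpM k)
    ((hpM (k + 1)).trans (by gcongr; exact antitone_gapTolerance k.le_succ))

lemma ofReal_log_one_add_norm_sq_le {E : Type*} [SeminormedAddGroup E] (x : E) :
    ENNReal.ofReal (Real.log (1 + ‖x‖ ^ 2)) ≤ ‖x‖ₑ ^ 2 := by
  rw [← ofReal_norm, ← ENNReal.ofReal_pow (norm_nonneg x)]
  refine ENNReal.ofReal_le_ofReal ?_
  linarith [Real.log_le_sub_one_of_pos (show 0 < 1 + ‖x‖ ^ 2 by positivity)]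

end OptimalPolicy
end FadingAWGN

theorem mainTheorem9_general {𝓢T : Type v} {𝓢R : Type w}
    [MeasurableSpace 𝓢T] [MeasurableSpace 𝓢R]
    (Q : Measure (ℂ × 𝓢T × 𝓢R)) [IsProbabilityMeasure Q]
    (hlog : ∫⁻ ω, ENNReal.ofReal (Real.log (1 + ‖ω.1‖ ^ 2)) ∂Q ≠ ∞) (P : ℝ≥0) :
    ∃ p ∈ FadingAWGN.powerPolicies Q P,
      (∀ q ∈ FadingAWGN.powerPolicies Q P,
        FadingAWGN.policyRate Q q ≤ FadingAWGN.policyRate Q p) ∧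
      FadingAWGN.policyRate Q p < ∞ ∧
      FadingAWGN.capacity.{u, v, w} Q P ≤ FadingAWGN.policyRate Q p := by
  obtain ⟨p, hp, hmax⟩ := FadingAWGN.exists_isMaxOn_policyRate hlog P
  refine ⟨p, hp, hmax, ?_, iSup₂_le fun A hA => ?_⟩
  · exact (le_iSup₂ (f := fun q _ => FadingAWGN.policyRate Q q) p hp).trans_lt
      (FadingAWGN.iSup_policyRate_ne_top hlog P).lt_top
  · have hfin : A.power Q ≠ ∞ := ne_top_of_le_ne_top ENNReal.coe_ne_top hA
    exact (A.condMutualInfo_le_policyRate hfin).trans (hmax (A.policy_mem_powerPolicies hA))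

theorem mainTheorem9 {𝓢T : Type v} {𝓢R : Type w}
    [MeasurableSpace 𝓢T] [MeasurableSpace 𝓢R]
    (Q : Measure (ℂ × 𝓢T × 𝓢R)) [IsProbabilityMeasure Q]
    (hH : ∫⁻ ω, ‖ω.1‖ₑ ^ 2 ∂Q = 1) (P : ℝ≥0) :
    ∃ p ∈ FadingAWGN.powerPolicies Q P,
      (∀ q ∈ FadingAWGN.powerPolicies Q P,
        FadingAWGN.policyRate Q q ≤ FadingAWGN.policyRate Q p) ∧
      FadingAWGN.policyRate Q p < ∞ ∧
      FadingAWGN.capacity.{u, v, w} Q P ≤ FadingAWGN.policyRate Q p :=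
  mainTheorem9_general Q (ne_top_of_le_ne_top (hH.trans_ne ENNReal.one_ne_top)
    (lintegral_mono fun ω => FadingAWGN.ofReal_log_one_add_norm_sq_le ω.1)) P
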